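/- A topological dynamical system is a pair $(X,T)$ with $X$ a compact metric space and $T:X\to X$ a homeomorphism; a set $A\subseteq X$ is invariant if $TA=A$. The system is minimal if $X$ is nonempty and has no proper nonempty closed invariant subset, and a minimal subset of $X$ is a closed invariant set $M\subseteq X$ such that $(M,T|_M)$ is a minimal system. A joining of $(X,T)$ and $(Y,S)$ is a closed set $J\subseteq X\times Y$ with $(T\times S)J=J$ that projects onto $X$ and onto $Y$; the two systems are disjoint if $X\times Y$ is their only joining. **Theorem A.** Let $(X,T)$ be a topological dynamical system. Then $(X,T)$ is disjoint from every minimal system if and only if there is a sequence $(M_i)_{i\in\mathbb{N}}$ of (not necessarily distinct) minimal subsets of $X$ such that $\overline{\bigcup_{i\in\mathbb{N}}M_i}=X$ and, for each $i$, the system $(M_i,T|_{M_i})$ is disjoint from $(X,T)$. -/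

import Mathlib

/-! ### Topological dynamical systems and disjointness

A topological dynamical system is a compact metric space `X` together with a homeomorphism
`T : X ≃ₜ X`. The notions below only depend on the topology, so they are stated for arbitrary
topological spaces; compactness and the metric are required wherever systems are quantified over. -/

universe u v

namespace TopDyn

section Basic

variable {X : Type u} {Y : Type v} [TopologicalSpace X] [TopologicalSpace Y]

/-- The restriction `T|_M` of a homeomorphism `T` to an invariant set `M` (that is, `T M = M`). -/
def restrict (T : X ≃ₜ X) (M : Set X) (hM : T '' M = M) : M ≃ₜ M :=
  (T.image M).trans (Homeomorph.setCongr hM)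

theorem restrict_apply (T : X ≃ₜ X) (M : Set X) (hM : T '' M = M) (x : M) :
    (restrict T M hM x : X) = T x := rfl

/-- `(X, T)` is a minimal system: `X` is nonempty and contains no proper nonempty closed
invariant subset. -/
def IsMinimalSystem (T : X ≃ₜ X) : Prop :=
  Nonempty X ∧ ∀ A : Set X, IsClosed A → T '' A = A → A.Nonempty → A = Set.univ

/-- `M` is a minimal subset of `(X, T)`: it is closed and invariant, and the subsystem `(M, T|_M)`
is minimal. -/
structure IsMinimalSubset (T : X ≃ₜ X) (M : Set X) : Prop where
  isClosed : IsClosed M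
  image_eq : T '' M = M
  isMinimalSystem : IsMinimalSystem (restrict T M image_eq)

/-- `J ⊆ X × Y` is a joining of `(X, T)` and `(Y, S)`: it is closed, it satisfies
`(T × S) J = J`, and it projects onto both coordinates. -/
structure IsJoining (T : X ≃ₜ X) (S : Y ≃ₜ Y) (J : Set (X × Y)) : Prop where
  isClosed : IsClosed J
  image_eq : T.prodCongr S '' J = J
  image_fst : Prod.fst '' J = Set.univ
  image_snd : Prod.snd '' J = Set.univ

/-- `(X, T) ⊥ (Y, S)`: the product `X × Y` is the unique joining of the two systems. -/
def AreDisjoint (T : X ≃ₜ X) (S : Y ≃ₜ Y) : Prop :=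
  {J : Set (X × Y) | IsJoining T S J} = {Set.univ}

end Basic

/-- `(X, T)` is disjoint from all minimal systems. The minimal systems range over the compact
metric spaces in a universe `v` that need not be the universe of `X`. -/
def DisjointFromAllMinimal {X : Type u} [TopologicalSpace X] (T : X ≃ₜ X) : Prop :=
  ∀ (Y : Type v) [MetricSpace Y] [CompactSpace Y] (S : Y ≃ₜ Y),
    IsMinimalSystem S → AreDisjoint T S

/-- `(X, T)` has dense disjoint minimal subsets: there is a sequence of minimal subsets `M i` of
`(X, T)` whose union is dense in `X`, and each subsystem `(M i, T)` is disjoint from `(X, T)`. -/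
def HasDDMS {X : Type u} [TopologicalSpace X] (T : X ≃ₜ X) : Prop :=
  ∃ (M : ℕ → Set X) (hM : ∀ i, IsMinimalSubset T (M i)),
    closure (⋃ i, M i) = Set.univ ∧ ∀ i, AreDisjoint (restrict T (M i) (hM i).image_eq) T

end TopDyn

-- Sufficiency. Let `J` be a joining of `X` with a minimal `Y`, and let `M` be a minimal subset
-- disjoint from `X`. Composing a minimal `Q ⊆ M × Y` with `J` through `Y` gives a joining of `M`
-- and `X`, hence all of `M × X`; its diagonal points show that `Q` meets `J`. The same holds for
-- every `(T ^ s × id) Q`, so by minimality all of these lie in `J`. Closedness and minimality of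
-- `M` then give `M × Y ⊆ J` (`IsJoining.prod_subset`), and density of the sets `M` gives `J = X ×
-- Y`.
--
-- Necessity. The point is that minimal subsets have dense union. Otherwise some closed `C` with
-- nonempty interior misses them all, and the visit sets `{n | T ^ n x ∈ C}` have arbitrarily long
-- gaps at bounded positions (`exists_uniform_gap`). Long gaps leave room to write all words of one
-- level while the other blocks avoid the visit set, which yields a minimal subshift, not
-- identically zero, with a point vanishing on each visit set (`exists_minimal_subshift_avoiding`).
-- The relation "`y` vanishes at the visits of `x` to the interior of `C`" is then a proper joining.

universe w

namespace TopDyn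

/-! ### Invariant sets and minimal subsets -/

section Minimal

variable {X : Type u} {Y : Type v} [TopologicalSpace X] [TopologicalSpace Y]

theorem image_eq_self_iff (T : X ≃ₜ X) (A : Set X) : T '' A = A ↔ ∀ x, T x ∈ A ↔ x ∈ A := by
  constructor
  · intro h x
    constructor
    · intro hx
      rw [← h] at hx
      obtain ⟨z, hz, hzx⟩ := hx
      rwa [← T.injective hzx]
    · intro hx
      rw [← h]
      exact ⟨x, hx, rfl⟩
  · intro h
    ext x
    constructor
    · rintro ⟨z, hz, rfl⟩
      exact (h z).2 hz
    · intro hx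
      exact ⟨T.symm x, (h _).1 (by simpa using hx), by simp⟩

theorem zpow_mem_iff {T : X ≃ₜ X} {A : Set X} (h : ∀ x, T x ∈ A ↔ x ∈ A) (n : ℤ) (x : X) :
    (T ^ n) x ∈ A ↔ x ∈ A := by
  induction n with
  | zero => simp
  | succ n ih =>
    rw [add_comm, zpow_add, zpow_one]
    exact (h _).trans ih
  | pred n ih =>
    rw [← ih, ← h, sub_eq_neg_add, zpow_add, zpow_neg_one, ← Homeomorph.mul_apply, mul_inv_cancel_left]

theorem IsMinimalSystem.eq_univ {T : X ≃ₜ X} (hT : IsMinimalSystem T) {A : Set X}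
    (hA : IsClosed A) (hinv : ∀ x, T x ∈ A ↔ x ∈ A) (hne : A.Nonempty) : A = Set.univ :=
  hT.2 A hA ((image_eq_self_iff T A).2 hinv) hne

theorem isMinimalSubset_iff (T : X ≃ₜ X) (M : Set X) :
    IsMinimalSubset T M ↔ IsClosed M ∧ (∀ x, T x ∈ M ↔ x ∈ M) ∧ M.Nonempty ∧
      ∀ A ⊆ M, IsClosed A → (∀ x, T x ∈ A ↔ x ∈ A) → A.Nonempty → A = M := by
  constructor
  · rintro ⟨hc, hi, hm⟩
    refine ⟨hc, (image_eq_self_iff T M).1 hi, Set.nonempty_coe_sort.1 hm.1, ?_⟩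
    intro A hAM hA hinv ⟨a, ha⟩
    have := hm.eq_univ (A := Subtype.val ⁻¹' A) (hA.preimage continuous_subtype_val)
      (fun x => hinv x) ⟨⟨a, hAM ha⟩, ha⟩
    refine hAM.antisymm fun x hx => ?_
    have hx' : (⟨x, hx⟩ : M) ∈ (Subtype.val ⁻¹' A : Set M) := this ▸ Set.mem_univ _
    exact hx'
  · rintro ⟨hc, hi, hne, hm⟩
    refine ⟨hc, (image_eq_self_iff T M).2 hi, hne.to_subtype, ?_⟩
    intro A hA hinv hAne
    rw [image_eq_self_iff] at hinv
    have := hm (Subtype.val '' A) (by rintro _ ⟨a, -, rfl⟩; exact a.2)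
      (hc.isClosedEmbedding_subtypeVal.isClosedMap A hA) ?_ (hAne.image _)
    · refine Set.eq_univ_of_forall fun x => ?_
      obtain ⟨a, ha, hax⟩ := this.symm.subset x.2
      rwa [← Subtype.ext hax]
    · intro x
      constructor
      · rintro ⟨a, ha, hax⟩
        have hxM : x ∈ M := (hi x).1 (hax ▸ a.2)
        refine ⟨⟨x, hxM⟩, (hinv _).1 ?_, rfl⟩
        have : restrict T M ((image_eq_self_iff T M).2 hi) ⟨x, hxM⟩ = a :=
          Subtype.ext (by rw [restrict_apply, hax])
        rwa [this]
      · rintro ⟨a, ha, rfl⟩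
        exact ⟨_, (hinv a).2 ha, rfl⟩

/-- In a compact space, every nonempty closed invariant set contains a minimal subset. -/
theorem exists_isMinimalSubset_subset [CompactSpace X] (T : X ≃ₜ X) {A : Set X}
    (hA : IsClosed A) (hinv : ∀ x, T x ∈ A ↔ x ∈ A) (hne : A.Nonempty) :
    ∃ M ⊆ A, IsMinimalSubset T M := by
  obtain ⟨M, hMA, hM⟩ := zorn_superset_nonempty
    {B : Set X | IsClosed B ∧ (∀ x, T x ∈ B ↔ x ∈ B) ∧ B.Nonempty} (by
      intro c hc hchain hcne
      refine ⟨⋂₀ c, ⟨isClosed_sInter fun B hB => (hc hB).1, fun x => ?_, ?_⟩,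
        fun B hB => Set.sInter_subset_of_mem hB⟩
      · simp only [Set.mem_sInter]
        exact forall₂_congr fun B hB => (hc hB).2.1 x
      · have := hcne.to_subtype
        rw [Set.sInter_eq_iInter]
        refine IsCompact.nonempty_iInter_of_directed_nonempty_isCompact_isClosed _ ?_
          (fun B => (hc B.2).2.2) (fun B => (hc B.2).1.isCompact) (fun B => (hc B.2).1)
        intro B C
        rcases hchain.total B.2 C.2 with h | h
        · exact ⟨B, subset_rfl, h⟩
        · exact ⟨C, h, subset_rfl⟩) A ⟨hA, hinv, hne⟩
  refine ⟨M, hMA, (isMinimalSubset_iff T M).2 ⟨hM.prop.1, hM.prop.2.1, hM.prop.2.2, ?_⟩⟩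
  intro B hBM hB hBinv hBne
  exact hM.eq_of_subset ⟨hB, hBinv, hBne⟩ hBM

end Minimal

/-! ### Joinings, disjointness and change of universe -/

section Disjoint

variable {X : Type u} {Y : Type v} [TopologicalSpace X] [TopologicalSpace Y]

theorem isJoining_iff (T : X ≃ₜ X) (S : Y ≃ₜ Y) (J : Set (X × Y)) :
    IsJoining T S J ↔ IsClosed J ∧ (∀ x y, (T x, S y) ∈ J ↔ (x, y) ∈ J) ∧
      (∀ x, ∃ y, (x, y) ∈ J) ∧ ∀ y, ∃ x, (x, y) ∈ J := by
  constructor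
  · rintro ⟨h1, h2, h3, h4⟩
    refine ⟨h1, fun x y => (image_eq_self_iff _ J).1 h2 (x, y), fun x => ?_, fun y => ?_⟩
    · obtain ⟨⟨a, b⟩, h, rfl⟩ := h3.symm.subset (Set.mem_univ x)
      exact ⟨b, h⟩
    · obtain ⟨⟨a, b⟩, h, rfl⟩ := h4.symm.subset (Set.mem_univ y)
      exact ⟨a, h⟩
  · rintro ⟨h1, h2, h3, h4⟩
    refine ⟨h1, (image_eq_self_iff _ J).2 fun p => h2 p.1 p.2,
      Set.eq_univ_of_forall fun x => ?_, Set.eq_univ_of_forall fun y => ?_⟩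
    · obtain ⟨y, h⟩ := h3 x
      exact ⟨(x, y), h, rfl⟩
    · obtain ⟨x, h⟩ := h4 y
      exact ⟨(x, y), h, rfl⟩

/-- The nonemptiness clause says that the full product is itself a joining; it matters because `X`
may be empty. -/
theorem areDisjoint_iff (T : X ≃ₜ X) (S : Y ≃ₜ Y) :
    AreDisjoint T S ↔ (Nonempty X ↔ Nonempty Y) ∧
      ∀ J : Set (X × Y), IsJoining T S J → J = Set.univ := by
  have key : IsJoining T S Set.univ ↔ (Nonempty X ↔ Nonempty Y) := by
    rw [isJoining_iff]
    constructor
    · rintro ⟨-, -, h3, h4⟩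
      exact ⟨fun ⟨x⟩ => ⟨(h3 x).choose⟩, fun ⟨y⟩ => ⟨(h4 y).choose⟩⟩
    · intro h
      exact ⟨isClosed_univ, by simp, fun x => ⟨(h.1 ⟨x⟩).some, trivial⟩,
        fun y => ⟨(h.2 ⟨y⟩).some, trivial⟩⟩
  rw [← key, AreDisjoint, Set.eq_singleton_iff_unique_mem]
  rfl

/-- Disjointness is symmetric and invariant under conjugation of one of the systems. -/
theorem AreDisjoint.symm_of_conj {Z : Type w} [TopologicalSpace Z] {T : X ≃ₜ X} {S : Y ≃ₜ Y}
    {R : Z ≃ₜ Z} (h : AreDisjoint T S) (e : Z ≃ₜ Y) (he : ∀ z, e (R z) = S (e z)) :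
    AreDisjoint R T := by
  rw [areDisjoint_iff] at h ⊢
  refine ⟨by rw [h.1]; exact e.toEquiv.nonempty_congr, fun J hJ => ?_⟩
  rw [isJoining_iff] at hJ
  obtain ⟨h1, h2, h3, h4⟩ := hJ
  have he' : ∀ y, e.symm (S y) = R (e.symm y) := fun y => by
    rw [e.symm_apply_eq, he, e.apply_symm_apply]
  have := h.2 {p | (e.symm p.2, p.1) ∈ J} ((isJoining_iff _ _ _).2
    ⟨h1.preimage (by fun_prop), fun x y => by simp [he', h2], fun x => ?_, fun y => h3 (e.symm y)⟩)
  · refine Set.eq_univ_of_forall fun ⟨z, x⟩ => ?_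
    have hm : (x, e z) ∈ {p : X × Y | (e.symm p.2, p.1) ∈ J} := this ▸ Set.mem_univ _
    simpa using hm
  · obtain ⟨z, hz⟩ := h4 x
    exact ⟨e z, by simpa using hz⟩

theorem IsMinimalSystem.of_conj {Z : Type w} [TopologicalSpace Z] {S : Y ≃ₜ Y} {R : Z ≃ₜ Z}
    (hR : IsMinimalSystem R) (e : Z ≃ₜ Y) (he : ∀ z, e (R z) = S (e z)) : IsMinimalSystem S := by
  refine ⟨hR.1.map e, fun A hA hinv hne => ?_⟩
  rw [image_eq_self_iff] at hinv
  have := hR.eq_univ (hA.preimage e.continuous) (fun z => by simp [he, hinv])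
    (hne.preimage e.surjective)
  rwa [Set.preimage_eq_univ_iff, e.surjective.range_eq, Set.univ_subset_iff] at this

/-- A compact metric space has at most continuum many points, so it has a copy in every universe. -/
theorem DisjointFromAllMinimal.areDisjoint {T : X ≃ₜ X} (h : DisjointFromAllMinimal.{u, v} T)
    {Z : Type w} [MetricSpace Z] [CompactSpace Z] (R : Z ≃ₜ Z) (hR : IsMinimalSystem R) :
    AreDisjoint R T := by
  have : Nonempty Z := hR.1
  have : Small.{v} Z := by
    -- A point is determined by its distances to a dense sequence.
    refine small_of_injective (β := ℕ → ℝ)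
      (f := fun z n => dist z (TopologicalSpace.denseSeq Z n)) fun a b hab => ?_
    have hd := TopologicalSpace.denseRange_denseSeq Z
    have : (fun z => dist a z) = fun z => dist b z :=
      hd.equalizer (by fun_prop) (by fun_prop) hab
    have := congrFun this b
    simpa using this
  let _ : MetricSpace (Shrink.{v} Z) :=
    MetricSpace.induced (equivShrink Z).symm (equivShrink Z).symm.injective inferInstance
  let e : Z ≃ₜ Shrink.{v} Z :=
    ((equivShrink Z).symm.toHomeomorphOfIsInducing ⟨rfl⟩).symm
  have : CompactSpace (Shrink.{v} Z) := e.compactSpace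
  exact (h _ ((e.symm.trans R).trans e) (hR.of_conj e fun z => by simp)).symm_of_conj e
    fun z => by simp

end Disjoint

/-! ### Dense disjoint minimal subsets suffice -/

section Sufficiency

variable {X : Type u} {Y : Type v} [TopologicalSpace X] [TopologicalSpace Y]
  [CompactSpace X] [CompactSpace Y]

theorem IsJoining.inter_nonempty {T : X ≃ₜ X} {S : Y ≃ₜ Y} (hS : IsMinimalSystem S)
    {J : Set (X × Y)} (hJ : IsJoining T S J) {M : Set X} (hM : IsMinimalSubset T M)
    (hMX : AreDisjoint (restrict T M hM.image_eq) T) {Q : Set (X × Y)} (hQ : IsClosed Q)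
    (hQinv : ∀ x y, (T x, S y) ∈ Q ↔ (x, y) ∈ Q) (hQne : Q.Nonempty) (hQM : ∀ p ∈ Q, p.1 ∈ M) :
    (Q ∩ J).Nonempty := by
  obtain ⟨hJc, hJinv, hJ1, hJ2⟩ := (isJoining_iff _ _ _).1 hJ
  obtain ⟨hMc, hMinv, ⟨m₀, hm₀⟩, hMmin⟩ := (isMinimalSubset_iff T M).1 hM
  have hQ1 : Prod.fst '' Q = M := by
    refine hMmin _ (by rintro _ ⟨p, hp, rfl⟩; exact hQM p hp)
      (isClosedMap_fst_of_compactSpace _ hQ) (fun x => ?_) (hQne.image _)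
    constructor
    · rintro ⟨⟨a, b⟩, h, rfl : a = T x⟩
      exact ⟨(x, S.symm b), (hQinv _ _).1 (by simpa using h), rfl⟩
    · rintro ⟨⟨a, b⟩, h, rfl⟩
      exact ⟨(T a, S b), (hQinv _ _).2 h, rfl⟩
  have hQ2 : Prod.snd '' Q = Set.univ := by
    refine hS.eq_univ (isClosedMap_snd_of_compactSpace _ hQ) (fun y => ?_) (hQne.image _)
    constructor
    · rintro ⟨⟨a, b⟩, h, rfl : b = S y⟩
      exact ⟨(T.symm a, y), (hQinv _ _).1 (by simpa using h), rfl⟩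
    · rintro ⟨⟨a, b⟩, h, rfl⟩
      exact ⟨(T a, S b), (hQinv _ _).2 h, rfl⟩
  -- The composition of `Q` and `J` through `Y` is a joining of `M` and `X`; a diagonal point of it
  -- gives a point of `Q ∩ J`.
  have hR := ((areDisjoint_iff _ _).1 hMX).2
    {p | ∃ y, ((p.1 : X), y) ∈ Q ∧ (p.2, y) ∈ J} ((isJoining_iff _ _ _).2 ⟨?_, ?_, ?_, ?_⟩)
  · have hm : ((⟨m₀, hm₀⟩, m₀) : M × X) ∈
        {p : M × X | ∃ y, ((p.1 : X), y) ∈ Q ∧ (p.2, y) ∈ J} := hR ▸ Set.mem_univ _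
    obtain ⟨y, h1, h2⟩ := hm
    exact ⟨(m₀, y), h1, h2⟩
  · have : IsClosed {q : (M × X) × Y | ((q.1.1 : X), q.2) ∈ Q ∧ (q.1.2, q.2) ∈ J} :=
      (hQ.preimage (by fun_prop)).inter (hJc.preimage (by fun_prop))
    convert isClosedMap_fst_of_compactSpace _ this using 1
    ext p
    simp
  · intro m x
    simp only [Set.mem_ofPred_eq, restrict_apply]
    constructor
    · rintro ⟨y, h1, h2⟩
      refine ⟨S.symm y, (hQinv _ _).1 ?_, (hJinv _ _).1 ?_⟩ <;> simpa
    · rintro ⟨y, h1, h2⟩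
      exact ⟨S y, (hQinv _ _).2 h1, (hJinv _ _).2 h2⟩
  · rintro ⟨m, hm⟩
    rw [← hQ1] at hm
    obtain ⟨⟨a, b⟩, h, rfl⟩ := hm
    obtain ⟨x, hx⟩ := hJ2 b
    exact ⟨x, b, h, hx⟩
  · intro x
    obtain ⟨y, hy⟩ := hJ1 x
    obtain ⟨⟨a, b⟩, h, rfl⟩ := hQ2.symm.subset (Set.mem_univ y)
    exact ⟨⟨a, hQM _ h⟩, b, h, hy⟩

/-- A joining of `X` with a minimal system contains `M × Y` for every minimal subset `M` that is
disjoint from `X`. The argument uses that `T ^ s × id` commutes with `T × S`. -/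
theorem IsJoining.prod_subset {T : X ≃ₜ X} {S : Y ≃ₜ Y} (hS : IsMinimalSystem S)
    {J : Set (X × Y)} (hJ : IsJoining T S J) {M : Set X} (hM : IsMinimalSubset T M)
    (hMX : AreDisjoint (restrict T M hM.image_eq) T) : M ×ˢ Set.univ ⊆ J := by
  obtain ⟨hJc, hJinv, -, -⟩ := (isJoining_iff _ _ _).1 hJ
  obtain ⟨hMc, hMinv, ⟨m₀, hm₀⟩, hMmin⟩ := (isMinimalSubset_iff T M).1 hM
  have hcomm : ∀ (s : ℤ) (x : X), (T ^ s) (T x) = T ((T ^ s) x) := fun s x => by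
    rw [← Homeomorph.mul_apply, ← Homeomorph.mul_apply, (Commute.zpow_self T s).eq]
  obtain ⟨Q, hQM, hQ⟩ := exists_isMinimalSubset_subset (T.prodCongr S)
    (hMc.prod (isClosed_univ (X := Y))) (fun p => by simp [hMinv])
    ⟨(m₀, hS.1.some), hm₀, trivial⟩
  obtain ⟨hQc, hQinv, hQne, hQmin⟩ := (isMinimalSubset_iff _ Q).1 hQ
  -- The set `φ ⁻¹' Q` is `(T ^ s × id) Q`, again closed, invariant and over `M`, so it meets `J`.
  -- Pulled back, `Q` meets a closed invariant set, which contains `Q` by minimality.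
  have hshift : ∀ (s : ℤ), ∀ p ∈ Q, ((T ^ s) p.1, p.2) ∈ J := by
    intro s
    let φ : X × Y → X × Y := fun p => ((T ^ (-s)) p.1, p.2)
    have hφ : ∀ x y, φ ((T ^ s) x, y) = (x, y) := fun x y => by
      simp only [φ, ← Homeomorph.mul_apply, ← zpow_add, neg_add_cancel, zpow_zero]; rfl
    obtain ⟨⟨a, b⟩, h1, h2⟩ := hJ.inter_nonempty hS hM hMX (Q := φ ⁻¹' Q)
      (hQc.preimage (by fun_prop))
      (fun x y => by
        simp only [φ, Set.mem_preimage, hcomm]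
        exact hQinv ((T ^ (-s)) x, y))
      (by
        obtain ⟨⟨x, y⟩, hp⟩ := hQne
        exact ⟨((T ^ s) x, y), by rw [Set.mem_preimage, hφ]; exact hp⟩)
      (fun p hp => (zpow_mem_iff hMinv (-s) p.1).1 (hQM hp).1)
    have := hQmin (Q ∩ {p | ((T ^ s) p.1, p.2) ∈ J}) Set.inter_subset_left
      (hQc.inter (hJc.preimage (by fun_prop)))
      (fun p => by
        refine and_congr (hQinv p) ?_
        simpa [hcomm] using hJinv ((T ^ s) p.1) p.2)
      ⟨φ (a, b), h1, by
        simp only [φ, Set.mem_ofPred_eq, ← Homeomorph.mul_apply, ← zpow_add, add_neg_cancel,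
          zpow_zero]
        exact h2⟩
    exact fun p hp => (this.symm.subset hp).2
  have hQ2 : Prod.snd '' Q = Set.univ := by
    refine hS.eq_univ (isClosedMap_snd_of_compactSpace _ hQc) (fun y => ?_) (hQne.image _)
    constructor
    · rintro ⟨⟨a, b⟩, h, rfl : b = S y⟩
      exact ⟨(T.symm a, y), (hQinv _).1 (by simpa using h), rfl⟩
    · rintro ⟨⟨a, b⟩, h, rfl⟩
      exact ⟨(T a, S b), (hQinv _).2 h, rfl⟩
  rintro ⟨m, y⟩ ⟨hm, -⟩
  obtain ⟨⟨a, b⟩, hab, rfl⟩ := hQ2.symm.subset (Set.mem_univ y)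
  -- The points of `M` whose whole orbit stays in the fibre of `J` over `b` form a closed invariant
  -- set containing `a`.
  have := hMmin (M ∩ ⋂ s : ℤ, {x | ((T ^ s) x, b) ∈ J}) Set.inter_subset_left
    (hMc.inter (isClosed_iInter fun s => hJc.preimage (by fun_prop)))
    (fun x => by
      refine and_congr (hMinv x) ?_
      simp only [Set.mem_iInter, Set.mem_ofPred_eq, ← Homeomorph.mul_apply, ← zpow_add_one]
      exact ⟨fun h s => by simpa using h (s - 1), fun h s => h (s + 1)⟩)
    ⟨a, (hQM hab).1, Set.mem_iInter.2 fun s => hshift s _ hab⟩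
  have h0 := Set.mem_iInter.1 (this.symm.subset hm).2 0
  simpa using h0

end Sufficiency

theorem HasDDMS.disjointFromAllMinimal {X : Type u} [MetricSpace X] [CompactSpace X]
    {T : X ≃ₜ X} (h : HasDDMS T) : DisjointFromAllMinimal.{u, v} T := by
  obtain ⟨M, hM, hd, hdis⟩ := h
  intro Y _ _ S hS
  obtain ⟨x₀⟩ := (hM 0).isMinimalSystem.1
  refine (areDisjoint_iff _ _).2 ⟨⟨fun _ => hS.1, fun _ => ⟨x₀⟩⟩, fun J hJ => ?_⟩
  refine Set.eq_univ_of_forall fun ⟨x, y⟩ => ?_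
  have hc : IsClosed {x | (x, y) ∈ J} := hJ.isClosed.preimage (by fun_prop)
  have hsub : (⋃ i, M i) ⊆ {x | (x, y) ∈ J} :=
    Set.iUnion_subset fun i x hx => hJ.prod_subset hS (hM i) (hdis i) ⟨hx, trivial⟩
  exact closure_minimal hsub hc (hd ▸ Set.mem_univ x)

/-! ### Minimal subshifts avoiding sets with long gaps -/

section Subshift

/-- The shift on two-sided binary sequences. -/
def shift : (ℤ → Bool) ≃ₜ (ℤ → Bool) where
  toFun y n := y (n + 1)
  invFun y n := y (n - 1)
  left_inv y := by simp
  right_inv y := by simp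
  continuous_toFun := by fun_prop
  continuous_invFun := by fun_prop

theorem shift_apply (y : ℤ → Bool) (n : ℤ) : shift y n = y (n + 1) := rfl

theorem translate_mem {B : Set (ℤ → Bool)} (hB : ∀ y, shift y ∈ B ↔ y ∈ B) {y : ℤ → Bool}
    (hy : y ∈ B) (s : ℤ) : (fun n => y (n + s)) ∈ B := by
  induction s with
  | zero => simpa using hy
  | succ s ih =>
    convert (hB _).2 ih using 1
    ext n
    rw [shift_apply]
    congr 1
    ring
  | pred s ih =>
    rw [← hB]
    convert ih using 1
    ext n
    rw [shift_apply]
    congr 1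
    ring

variable (q : ℕ → ℕ)

/-- The lengths of the words of each level: a word of level `k + 1` is a concatenation of
`q (wordLength q k)` words of level `k`. -/
def wordLength : ℕ → ℕ
  | 0 => 1
  | k + 1 => q (wordLength k) * wordLength k

/-- `IsWord q k y` says that the restriction of `y` to `[0, wordLength q k)` is a word of level `k`:
every word of length one has level `0`, and a word of level `k + 1` is a concatenation of words of
level `k` among which all of them occur. -/
def IsWord : ℕ → (ℤ → Bool) → Prop
  | 0, _ => True
  | k + 1, y =>
    (∀ i < q (wordLength q k), IsWord k fun n => y (i * wordLength q k + n)) ∧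
      ∀ u, IsWord k u → ∃ i < q (wordLength q k), ∀ t < wordLength q k,
        y (i * wordLength q k + t) = u t

variable {q}

theorem IsWord.congr {k : ℕ} {y z : ℤ → Bool} (hy : IsWord q k y)
    (h : ∀ t : ℕ, t < wordLength q k → y t = z t) : IsWord q k z := by
  induction k generalizing y z with
  | zero => trivial
  | succ k ih =>
    have hlt : ∀ i < q (wordLength q k), ∀ t < wordLength q k,
        y (i * wordLength q k + t) = z (i * wordLength q k + t) := by
      intro i hi t ht
      have := h (i * wordLength q k + t) (by rw [wordLength]; nlinarith)
      push_cast at this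
      exact this
    refine ⟨fun i hi => ih (hy.1 i hi) fun t ht => hlt i hi t ht, fun u hu => ?_⟩
    obtain ⟨i, hi, hiu⟩ := hy.2 u hu
    exact ⟨i, hi, fun t ht => (hlt i hi t ht).symm.trans (hiu t ht)⟩

theorem wordLength_dvd {j k : ℕ} (h : j ≤ k) : wordLength q j ∣ wordLength q k := by
  induction k, h using Nat.le_induction with
  | base => exact dvd_rfl
  | succ k _ ih => exact ih.mul_left _

theorem lt_wordLength (hq : ∀ B, 2 ≤ q B) (k : ℕ) : k < wordLength q k := by
  induction k with
  | zero => simp [wordLength]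
  | succ k ih =>
    rw [wordLength]
    nlinarith [hq (wordLength q k)]

theorem wordLength_mono (hq : ∀ B, 2 ≤ q B) : Monotone (wordLength q) := fun _ k h =>
  Nat.le_of_dvd ((Nat.zero_le k).trans_lt (lt_wordLength hq k)) (wordLength_dvd h)

theorem IsWord.block (hq : ∀ B, 2 ≤ q B) {j k : ℕ} (h : j ≤ k) {y : ℤ → Bool} (hy : IsWord q k y)
    (i : ℕ) (hi : (i + 1) * wordLength q j ≤ wordLength q k) :
    IsWord q j fun n => y (i * wordLength q j + n) := by
  induction k, h using Nat.le_induction generalizing y i with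
  | base =>
    have hpos := (Nat.zero_le j).trans_lt (lt_wordLength hq j)
    obtain rfl : i = 0 := by
      by_contra h0
      have : 1 ≤ i := Nat.one_le_iff_ne_zero.2 h0
      nlinarith
    simpa using hy
  | succ k hk ih =>
    obtain ⟨c, hc⟩ := wordLength_dvd (q := q) hk
    have hjpos := (Nat.zero_le j).trans_lt (lt_wordLength hq j)
    have hkpos := (Nat.zero_le k).trans_lt (lt_wordLength hq k)
    have hcpos : 0 < c := Nat.pos_of_ne_zero fun h0 => by simp [h0] at hc; omega
    rw [wordLength, hc] at hi
    have hi' : i < q (wordLength q k) * c := by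
      rw [hc]
      by_contra hcon
      push Not at hcon
      nlinarith
    -- Each level `k` word consists of `c` blocks of level `j`, so block `i` is block `i % c` of the
    -- level `k` word number `i / c`.
    have ha : i / c < q (wordLength q k) :=
      Nat.div_lt_of_lt_mul (by rwa [mul_comm])
    have hb : (i % c + 1) * wordLength q j ≤ wordLength q k := by
      rw [hc, mul_comm]
      exact Nat.mul_le_mul_left _ (Nat.mod_lt _ hcpos)
    convert ih (hy.1 _ ha) (i % c) hb using 3
    rw [← add_assoc]
    congr 1
    have : (i : ℤ) = c * (i / c : ℕ) + (i % c : ℕ) := by exact_mod_cast (Nat.div_add_mod i c).symm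
    have hc' : (wordLength q k : ℤ) = wordLength q j * c := by exact_mod_cast hc
    rw [hc']
    nth_rewrite 1 [this]
    ring

variable (q) in
/-- The subshift of those sequences all of whose windows occur in words of some level. -/
def wordShift : Set (ℤ → Bool) :=
  {y | ∀ R : ℕ, ∃ k u, IsWord q k u ∧ ∃ s : ℤ, R ≤ s ∧ s + R < wordLength q k ∧
    ∀ n : ℤ, |n| ≤ R → y n = u (s + n)}

/-- Such a set is the preimage of a subset of a finite discrete space. -/
theorem isClosed_of_window {E : Set (ℤ → Bool)} (R : ℕ)
    (h : ∀ y z : ℤ → Bool, (∀ n : ℤ, |n| ≤ R → y n = z n) → y ∈ E → z ∈ E) : IsClosed E := by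
  let r : (ℤ → Bool) → (Set.Icc (-R : ℤ) R → Bool) := fun y n => y n
  have hr : Continuous r := by fun_prop
  have : E = r ⁻¹' (r '' E) := by
    refine (Set.subset_preimage_image r E).antisymm ?_
    rintro z ⟨y, hy, hyz⟩
    exact h y z (fun n hn => congrFun hyz ⟨n, abs_le.1 hn⟩) hy
  rw [this]
  exact (isClosed_discrete _).preimage hr

theorem isClosed_wordShift : IsClosed (wordShift q) := by
  rw [wordShift, Set.ofPred_forall]
  refine isClosed_iInter fun R => isClosed_of_window R ?_
  rintro y z h ⟨k, u, hu, s, h1, h2, h3⟩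
  exact ⟨k, u, hu, s, h1, h2, fun n hn => (h n hn).symm.trans (h3 n hn)⟩

theorem shift_mem_wordShift_iff (y : ℤ → Bool) : shift y ∈ wordShift q ↔ y ∈ wordShift q := by
  constructor
  · intro h R
    obtain ⟨k, u, hu, s, h1, h2, h3⟩ := h (R + 1)
    push_cast at h1 h2 h3
    refine ⟨k, u, hu, s - 1, by omega, by omega, fun n hn => ?_⟩
    have := h3 (n - 1) (by rw [abs_le] at hn ⊢; omega)
    rw [shift_apply, sub_add_cancel] at this
    rw [this]
    congr 1
    ring
  · intro h R
    obtain ⟨k, u, hu, s, h1, h2, h3⟩ := h (R + 1)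
    push_cast at h1 h2 h3
    refine ⟨k, u, hu, s + 1, by omega, by omega, fun n hn => ?_⟩
    rw [shift_apply, h3 (n + 1) (by rw [abs_le] at hn ⊢; omega)]
    congr 1
    ring

/-- Every word occurs in every element of the subshift. -/
theorem exists_occurrence (hq : ∀ B, 2 ≤ q B) {y : ℤ → Bool} (hy : y ∈ wordShift q) {k : ℕ}
    {u : ℤ → Bool} (hu : IsWord q k u) :
    ∃ σ : ℤ, ∀ t : ℤ, 0 ≤ t → t < wordLength q k → y (t + σ) = u t := by
  obtain ⟨l, w, hw, s, h1, h2, h3⟩ := hy (wordLength q (k + 1))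
  have hkl : k + 1 ≤ l := by
    by_contra! hlt
    have := wordLength_mono hq hlt.le
    omega
  have hB : (0 : ℤ) < wordLength q (k + 1) := by
    exact_mod_cast (Nat.zero_le _).trans_lt (lt_wordLength hq (k + 1))
  lift s to ℕ using by omega
  set B := wordLength q (k + 1) with hBdef
  have e1 : (s - 1) / B * B + (s - 1) % B = s - 1 := Nat.div_add_mod' _ _
  have e2 : (s - 1) % B < B := Nat.mod_lt _ (by exact_mod_cast hB)
  -- The aligned block `[i * B, (i + 1) * B)` lies within distance `B` of `s`, hence in the window
  -- copied from `y`; being of level `k + 1`, it contains every word of level `k`.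
  set i := (s - 1) / B
  have hblock := hw.block hq hkl i (by rw [← hBdef]; push_cast [add_mul]; omega)
  obtain ⟨a, ha, hau⟩ := hblock.2 u hu
  refine ⟨i * B + a * wordLength q k - s, fun t ht0 ht => ?_⟩
  lift t to ℕ using ht0
  have ha' : a * wordLength q k + t < B := by
    rw [hBdef, wordLength]
    have : t < wordLength q k := by exact_mod_cast ht
    nlinarith
  rw [h3, ← hau t (by exact_mod_cast ht)]
  · congr 1
    ring
  · have e1' : (i : ℤ) * B + ((s - 1) % B : ℕ) = s - 1 := by
      zify [show 1 ≤ s by omega] at e1 ⊢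
      exact e1
    have ha'' : (a : ℤ) * wordLength q k + t < B := by exact_mod_cast ha'
    have : (0 : ℤ) ≤ a * wordLength q k := by positivity
    rw [abs_le]
    constructor <;> omega

/-- Each window of `z` sits in a word, and that word occurs in `y`; so translates of `y` converge to
`z`. -/
theorem isMinimalSubset_wordShift (hq : ∀ B, 2 ≤ q B) (hne : (wordShift q).Nonempty) :
    IsMinimalSubset shift (wordShift q) := by
  refine (isMinimalSubset_iff _ _).2 ⟨isClosed_wordShift, shift_mem_wordShift_iff, hne, ?_⟩
  rintro B hB hBc hBinv ⟨y, hy⟩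
  refine hB.antisymm fun z hz => ?_
  have key : ∀ R : ℕ, ∃ b ∈ B, ∀ n : ℤ, |n| ≤ R → b n = z n := by
    intro R
    obtain ⟨k, u, hu, s, h1, h2, h3⟩ := hz R
    obtain ⟨σ, hσ⟩ := exists_occurrence hq (hB hy) hu
    refine ⟨_, translate_mem hBinv hy (s + σ), fun n hn => ?_⟩
    rw [h3 n hn]
    rw [abs_le] at hn
    rw [← hσ (s + n) (by omega) (by omega)]
    congr 1
    ring
  choose b hbB hb using key
  refine hBc.mem_of_tendsto (f := b) (b := Filter.atTop) (tendsto_pi_nhds.2 fun n => ?_)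
    (Filter.Eventually.of_forall hbB)
  refine tendsto_const_nhds.congr' ?_
  filter_upwards [Filter.eventually_ge_atTop n.natAbs] with R hR
  exact (hb R n (by rw [Int.abs_eq_natAbs]; exact_mod_cast hR)).symm

/-- Words of every level can be chosen to avoid a given member of a family of sets of integers all
of whose members have sufficiently long gaps. -/
theorem exists_isWord_avoiding {F : Set (Set ℤ)} (hF : ∀ A ∈ F, ∀ s : ℤ, {n | s + n ∈ A} ∈ F)
    (hq : ∀ B, 0 < B → ∀ A ∈ F, ∃ i : ℕ, i + Fintype.card (Fin B → Bool) ≤ q B ∧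
      ∀ t < Fintype.card (Fin B → Bool) * B, (i * B + t : ℤ) ∉ A) (hq2 : ∀ B, 2 ≤ q B) (k : ℕ) :
    ∀ A ∈ F, ∃ u, IsWord q k u ∧ ∀ t < wordLength q k, u t = true → (t : ℤ) ∉ A := by
  classical
  induction k with
  | zero => exact fun A _ => ⟨fun _ => false, trivial, by simp⟩
  | succ k ih =>
    intro A hA
    have hB : 0 < wordLength q k := (Nat.zero_le k).trans_lt (lt_wordLength hq2 k)
    obtain ⟨i₀, hi₀, hfree⟩ := hq _ hB A hA
    rw [wordLength]
    set B := wordLength q k with hBdef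
    choose v hv hvA using fun j : ℕ => ih _ (hF A hA (j * B))
    let ext : (Fin B → Bool) → ℤ → Bool := fun c n =>
      if h : n.toNat < B then c ⟨n.toNat, h⟩ else false
    let e := (Fintype.equivFin (Fin B → Bool)).symm
    -- The blocks from `i₀` on, one for each binary string of length `B`, miss `A` and list all
    -- words of level `k`. Every other block, and every slot whose string is not a word, receives `v
    -- j`, which avoids the translate of `A` seen from block `j`.
    let piece : ℕ → ℤ → Bool := fun j =>
      if h : i₀ ≤ j ∧ j - i₀ < Fintype.card (Fin B → Bool) then
        if IsWord q k (ext (e ⟨j - i₀, h.2⟩)) then ext (e ⟨j - i₀, h.2⟩) else v j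
      else v j
    let y : ℤ → Bool := fun n => piece (n / B).toNat (n % B)
    have hy : ∀ j t : ℕ, t < B → y (j * B + t) = piece j t := by
      intro j t ht
      have h1 : ((j * B + t : ℤ) / B) = j := by
        rw [add_comm, Int.add_mul_ediv_right _ _ (by omega),
          Int.ediv_eq_zero_of_lt (by omega) (by omega), zero_add]
      have h2 : ((j * B + t : ℤ) % B) = t := by
        rw [add_comm, Int.add_mul_emod_self_right, Int.emod_eq_of_lt (by omega) (by omega)]
      simp only [y, h1, h2, Int.toNat_natCast]
    have hpiece : ∀ j, IsWord q k (piece j) := by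
      intro j
      simp only [piece]
      split_ifs with h1 h2
      exacts [h2, hv j, hv j]
    refine ⟨y, ⟨fun j _ => (hpiece j).congr fun t ht => (hy j t ht).symm, fun u hu => ?_⟩, ?_⟩
    · have hext : ∀ t : ℕ, t < B → u t = ext (fun t => u t) t := fun t ht => by
        simp [ext, ht]
      set c : Fin B → Bool := fun t => u t with hc
      refine ⟨i₀ + e.symm c, by have := (e.symm c).2; rw [← hBdef]; omega, fun t ht => ?_⟩
      rw [hy _ t ht, hext t ht]
      have hw := hu.congr hext
      simp only [piece]
      rw [dif_pos ⟨by omega, by rw [Nat.add_sub_cancel_left]; exact (e.symm c).2⟩]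
      simp [hw]
    · intro t ht hyt
      have hj : t / B < q B := Nat.div_lt_of_lt_mul (by rwa [mul_comm])
      have hr : t % B < B := Nat.mod_lt _ hB
      have hdecomp : (t : ℤ) = (t / B : ℕ) * B + (t % B : ℕ) := by
        exact_mod_cast (Nat.div_add_mod' t B).symm
      rw [hdecomp, hy _ _ hr] at hyt
      rw [hdecomp]
      simp only [piece] at hyt
      split_ifs at hyt with h1 h2
      · have := hfree ((t / B - i₀) * B + t % B) (by nlinarith)
        have e : ((t / B : ℕ) : ℤ) * B + (t % B : ℕ) =
            i₀ * B + ((t / B - i₀) * B + t % B : ℕ) := by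
          rw [Nat.cast_add, Nat.cast_mul, Nat.cast_sub h1.1]
          ring
        rwa [e]
      · exact hvA _ _ hr hyt
      · exact hvA _ _ hr hyt

/-- If the members of a translation-invariant family of sets of integers have arbitrarily long
gaps, at uniformly bounded positions, then there is a nontrivial minimal subshift that contains for
each member of the family a sequence vanishing on it. -/
theorem exists_minimal_subshift_avoiding {F : Set (Set ℤ)} (hne : F.Nonempty)
    (hF : ∀ A ∈ F, ∀ s : ℤ, {n | s + n ∈ A} ∈ F)
    (hgap : ∀ L : ℕ, ∃ N : ℕ, ∀ A ∈ F, ∃ n ≤ N, ∀ t < L, (n + t : ℤ) ∉ A) :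
    ∃ Y, IsMinimalSubset shift Y ∧ (∃ y ∈ Y, y 0 = true) ∧
      ∀ A ∈ F, ∃ y ∈ Y, ∀ n, y n = true → n ∉ A := by
  have hgap' : ∀ B, ∃ Q : ℕ, 2 ≤ Q ∧ (0 < B → ∀ A ∈ F, ∃ i : ℕ,
      i + Fintype.card (Fin B → Bool) ≤ Q ∧
      ∀ t < Fintype.card (Fin B → Bool) * B, (i * B + t : ℤ) ∉ A) := by
    intro B
    -- The extra `B` pays for rounding the start of the gap up to a multiple of `B`.
    obtain ⟨N, hN⟩ := hgap ((Fintype.card (Fin B → Bool) + 1) * B)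
    refine ⟨N + 2 + Fintype.card (Fin B → Bool), by omega, fun hB A hA => ?_⟩
    obtain ⟨n, hn, h⟩ := hN A hA
    have h1 := Nat.div_add_mod' n B
    have h2 := Nat.mod_lt n hB
    refine ⟨n / B + 1, by have := Nat.div_le_self n B; omega, fun t ht => ?_⟩
    have := h (B - n % B + t) (by rw [add_mul]; omega)
    have e : (((n / B + 1 : ℕ) : ℤ) * B + t) = n + (B - n % B + t : ℕ) := by
      have h1' : ((n / B : ℕ) : ℤ) * B + (n % B : ℕ) = n := by exact_mod_cast h1
      rw [Nat.cast_add (B - n % B), Nat.cast_sub h2.le, Nat.cast_add, Nat.cast_one, add_mul]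
      linarith
    rwa [e]
  choose q hq2 hq using hgap'
  have havoid : ∀ A ∈ F, ∃ y ∈ wordShift q, ∀ n, y n = true → n ∉ A := by
    intro A hA
    -- Quantifying over all `r ≤ R` makes the closed sets `E R` decreasing; a point of their
    -- intersection lies in the subshift and vanishes on `A`.
    let E : ℕ → Set (ℤ → Bool) := fun R =>
      {y | (∀ n, y n = true → n ∉ A) ∧ ∀ r : ℕ, r ≤ R → ∃ k u, IsWord q k u ∧ ∃ s : ℤ, r ≤ s ∧
        s + r < wordLength q k ∧ ∀ n : ℤ, |n| ≤ r → y n = u (s + n)}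
    have hE : ∀ R, IsClosed (E R) := by
      intro R
      have h1 : IsClosed {y : ℤ → Bool | ∀ n, y n = true → n ∉ A} := by
        rw [Set.ofPred_forall]
        refine isClosed_iInter fun n => isClosed_of_window n.natAbs ?_
        intro y z h hy hz
        exact hy ((h n (Int.abs_eq_natAbs n).le).trans hz)
      refine h1.inter (isClosed_of_window R fun y z h hy r hr => ?_)
      obtain ⟨k, u, hu, s, h1, h2, h3⟩ := hy r hr
      exact ⟨k, u, hu, s, h1, h2, fun n hn => (h n (by omega)).symm.trans (h3 n hn)⟩
    have hEne : ∀ R, (E R).Nonempty := by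
      intro R
      -- A word of level `2 * R + 1` is longer than `2 * R + 1`, so the window of radius `R` about
      -- position `R` fits in it; recentring there accounts for the translate of `A` by `-R`.
      obtain ⟨u, hu, huA⟩ := exists_isWord_avoiding hF hq hq2 (2 * R + 1) _ (hF A hA (-R))
      have hlen := lt_wordLength hq2 (2 * R + 1)
      refine ⟨fun n => if |n| ≤ R then u (R + n) else false, fun n hn => ?_, fun r hr => ?_⟩
      · beta_reduce at hn
        split_ifs at hn with h
        · rw [abs_le] at h
          have := huA (R + n).toNat (by omega)
          rw [Int.toNat_of_nonneg (by omega)] at this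
          simpa using this hn
      · refine ⟨_, u, hu, R, by omega, by omega, fun n hn => ?_⟩
        exact if_pos (by omega)
    obtain ⟨y, hy⟩ := IsCompact.nonempty_iInter_of_sequence_nonempty_isCompact_isClosed E
      (fun R y hy => ⟨hy.1, fun r hr => hy.2 r (by omega)⟩) hEne (hE 0).isCompact hE
    rw [Set.mem_iInter] at hy
    exact ⟨y, fun R => (hy R).2 R le_rfl, (hy 0).1⟩
  obtain ⟨A, hA⟩ := hne
  obtain ⟨y, hy, -⟩ := havoid A hA
  refine ⟨_, isMinimalSubset_wordShift hq2 ⟨y, hy⟩, ?_, havoid⟩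
  obtain ⟨σ, hσ⟩ := exists_occurrence hq2 hy (k := 0) (u := fun _ => true) trivial
  exact ⟨_, translate_mem shift_mem_wordShift_iff hy σ, hσ 0 le_rfl (by simp [wordLength])⟩

end Subshift

/-! ### Disjointness from minimal systems forces dense minimal subsets -/

section Necessity

variable {X : Type u} [MetricSpace X] [CompactSpace X]

theorem exists_uniform_gap (T : X ≃ₜ X) {C : Set X} (hC : IsClosed C)
    (hCM : ∀ M, IsMinimalSubset T M → Disjoint M C) (L : ℕ) :
    ∃ N : ℕ, ∀ x, ∃ n ≤ N, ∀ t < L, (T ^ (n + t : ℤ)) x ∉ C := by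
  have hpt : ∀ x, ∃ n : ℤ, ∀ t < L, (T ^ (n + t : ℤ)) x ∉ C := by
    by_contra! hcon
    -- The points that visit `C` in every time window of length `L` form a closed invariant set; a
    -- minimal subset inside it would meet `C`.
    let D : Set X := {x | ∀ n : ℤ, ∃ t < L, (T ^ (n + t : ℤ)) x ∈ C}
    have hD : IsClosed D := by
      simp only [D, Set.ofPred_forall]
      refine isClosed_iInter fun n => ?_
      have : {x | ∃ t < L, (T ^ (n + t : ℤ)) x ∈ C} =
          ⋃ t ∈ Finset.range L, (T ^ (n + t : ℤ)) ⁻¹' C := by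
        ext x
        simp
      rw [this]
      exact isClosed_biUnion_finset fun t _ => hC.preimage (T ^ (n + t : ℤ)).continuous
    obtain ⟨M, hMD, hM⟩ := exists_isMinimalSubset_subset T hD (fun x => by
      simp only [D, Set.mem_ofPred_eq, ← Homeomorph.mul_apply, ← zpow_add_one]
      constructor
      · intro h n
        obtain ⟨t, ht, hx⟩ := h (n - 1)
        exact ⟨t, ht, by rwa [show n - 1 + t + 1 = n + t by ring] at hx⟩
      · intro h n
        obtain ⟨t, ht, hx⟩ := h (n + 1)
        exact ⟨t, ht, by rwa [show n + 1 + t = n + t + 1 by ring] at hx⟩) hcon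
    obtain ⟨-, hinv, ⟨m, hm⟩, -⟩ := (isMinimalSubset_iff T M).1 hM
    obtain ⟨t, -, ht⟩ := hMD hm 0
    exact Set.disjoint_left.1 (hCM M hM) ((zpow_mem_iff hinv _ m).2 hm) ht
  let O : ℤ → Set X := fun n => {x | ∀ t < L, (T ^ (n + t : ℤ)) x ∉ C}
  have hO : ∀ n, IsOpen (O n) := by
    intro n
    have : O n = ⋂ t ∈ Finset.range L, (T ^ (n + t : ℤ)) ⁻¹' Cᶜ := by
      ext x
      simp [O]
    rw [this]
    exact isOpen_biInter_finset fun t _ => hC.isOpen_compl.preimage (T ^ (n + t : ℤ)).continuous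
  obtain ⟨s, hs⟩ := isCompact_univ.elim_finite_subcover O hO
    fun x _ => Set.mem_iUnion.2 (hpt x)
  let N := s.sup Int.natAbs
  refine ⟨2 * N, fun x => ?_⟩
  -- Starting from `T ^ N x` turns a gap position `n ∈ [-N, N]` into `n + N ∈ [0, 2 * N]`.
  obtain ⟨n, hn, hx⟩ := Set.mem_iUnion₂.1 (hs (Set.mem_univ ((T ^ (N : ℤ)) x)))
  have hnN : n.natAbs ≤ N := Finset.le_sup (f := Int.natAbs) hn
  refine ⟨(n + N).toNat, by omega, fun t ht => ?_⟩
  have := hx t ht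
  rw [← Homeomorph.mul_apply, ← zpow_add] at this
  rwa [Int.toNat_of_nonneg (by omega), add_right_comm]

theorem DisjointFromAllMinimal.dense {T : X ≃ₜ X} (h : DisjointFromAllMinimal.{u, v} T) :
    Dense (⋃₀ {M | IsMinimalSubset T M}) := by
  rw [dense_iff_closure_eq]
  by_contra hne
  obtain ⟨x₀, hx₀⟩ := (Set.ne_univ_iff_exists_notMem _).1 hne
  obtain ⟨C, hCx, hC, hCsub⟩ := exists_mem_nhds_isClosed_subset
    (isClosed_closure.isOpen_compl.mem_nhds hx₀)
  have hCM : ∀ M, IsMinimalSubset T M → Disjoint M C := fun M hM =>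
    Set.disjoint_left.2 fun x hxM hxC => hCsub hxC (subset_closure ⟨M, hM, hxM⟩)
  obtain ⟨Y, hY, ⟨y₁, hy₁, hy₁0⟩, hYav⟩ := exists_minimal_subshift_avoiding
    (F := Set.range fun x => {n : ℤ | (T ^ n) x ∈ C}) ⟨_, x₀, rfl⟩ (by
      rintro _ ⟨x, rfl⟩ s
      refine ⟨(T ^ s) x, ?_⟩
      ext n
      simp only [Set.mem_ofPred_eq, ← Homeomorph.mul_apply, ← zpow_add, add_comm]) (by
      intro L
      obtain ⟨N, hN⟩ := exists_uniform_gap T hC hCM L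
      refine ⟨N, ?_⟩
      rintro _ ⟨x, rfl⟩
      exact hN x)
  have : CompactSpace Y := isCompact_iff_compactSpace.1 hY.isClosed.isCompact
  let _ : MetricSpace Y := TopologicalSpace.metrizableSpaceMetric Y
  have hdis := h.areDisjoint _ hY.isMinimalSystem
  -- The interior makes the hypothesis an open condition, so that `J` is closed.
  let J : Set (Y × X) := {p | ∀ n : ℤ, (T ^ n) p.2 ∈ interior C → (p.1 : ℤ → Bool) n = false}
  have hJc : IsClosed J := by
    simp only [J, Set.ofPred_forall, imp_iff_not_or]
    refine isClosed_iInter fun n => IsClosed.union ?_ ?_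
    · exact (isOpen_interior.preimage
        ((T ^ n).continuous.comp continuous_snd)).isClosed_compl
    · exact isClosed_eq ((continuous_apply n).comp (continuous_subtype_val.comp continuous_fst))
        continuous_const
  have hJinv : ∀ y x, (restrict shift Y hY.image_eq y, T x) ∈ J ↔ (y, x) ∈ J := by
    intro y x
    simp only [J, Set.mem_ofPred_eq, restrict_apply, shift_apply, ← Homeomorph.mul_apply,
      ← zpow_add_one]
    exact ⟨fun h n => by simpa using h (n - 1), fun h n => h (n + 1)⟩
  have hJ2 : ∀ x, ∃ y, (y, x) ∈ J := by
    intro x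
    obtain ⟨y, hy, hyx⟩ := hYav _ ⟨x, rfl⟩
    refine ⟨⟨y, hy⟩, fun n hn => ?_⟩
    by_contra hyn
    have hnC : (T ^ n) x ∈ C := interior_subset hn
    exact hyx n (by simpa using hyn) hnC
  have hJ1 : Prod.fst '' J = Set.univ := by
    obtain ⟨y₂, hy₂⟩ := hJ2 x₀
    refine hY.isMinimalSystem.eq_univ (isClosedMap_fst_of_compactSpace _ hJc) (fun y => ?_)
      ⟨y₂, _, hy₂, rfl⟩
    constructor
    · rintro ⟨⟨a, b⟩, hab, rfl : a = _⟩
      exact ⟨(y, T.symm b), (hJinv _ _).1 (by simpa using hab), rfl⟩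
    · rintro ⟨⟨a, b⟩, hab, rfl⟩
      exact ⟨_, (hJinv _ _).2 hab, rfl⟩
  have hJ := ((areDisjoint_iff _ _).1 hdis).2 J ((isJoining_iff _ _ _).2
    ⟨hJc, hJinv, fun y => ?_, hJ2⟩)
  -- `J` is proper: `x₀` is interior to `C` while `y₁` takes the value `true` at time `0`.
  · have hmem : ((⟨y₁, hy₁⟩, x₀) : Y × X) ∈ J := hJ ▸ Set.mem_univ _
    have := hmem 0 (by simpa using mem_interior_iff_mem_nhds.2 hCx)
    simp [hy₁0] at this
  · obtain ⟨⟨a, b⟩, hab, rfl⟩ := hJ1.symm.subset (Set.mem_univ y)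
    exact ⟨b, hab⟩

theorem DisjointFromAllMinimal.hasDDMS {T : X ≃ₜ X} (h : DisjointFromAllMinimal.{u, v} T) :
    HasDDMS T := by
  -- The one-point system is minimal, and disjointness from it forces `X` to be nonempty.
  have hpt : AreDisjoint (Homeomorph.refl PUnit.{1}) T :=
    h.areDisjoint _ ⟨inferInstance, fun A _ _ hA => Set.eq_univ_of_forall fun _ => by
      obtain ⟨⟨⟩, ha⟩ := hA
      exact ha⟩
  have hX : Nonempty X := ((areDisjoint_iff _ _).1 hpt).1.1 ⟨⟨⟩⟩
  have hd := h.dense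
  have : Nonempty ↥(⋃₀ {M | IsMinimalSubset T M}) := hd.nonempty.to_subtype
  choose M hM hxM using fun i : ℕ =>
    (TopologicalSpace.denseSeq ↥(⋃₀ {M | IsMinimalSubset T M}) i).2
  refine ⟨M, hM, ?_, fun i => ?_⟩
  · rw [← dense_iff_closure_eq]
    refine (hd.denseRange_val.comp (TopologicalSpace.denseRange_denseSeq _)
      continuous_subtype_val).mono ?_
    rintro _ ⟨i, rfl⟩
    exact Set.mem_iUnion.2 ⟨i, hxM i⟩
  · have : CompactSpace (M i) := isCompact_iff_compactSpace.1 (hM i).isClosed.isCompact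
    exact h.areDisjoint _ (hM i).isMinimalSystem

end Necessity

end TopDyn

theorem theoremA (X : Type u) [MetricSpace X] [CompactSpace X] (T : X ≃ₜ X) :
    TopDyn.DisjointFromAllMinimal.{u, v} T ↔ TopDyn.HasDDMS T :=
  ⟨fun h => h.hasDDMS, fun h => h.disjointFromAllMinimal⟩
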